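/- **Theorem 1.** Let $\mathcal I$ be a finite set, $\pi$ a probability distribution on $\mathcal I$, and write $\pi(f)=\sum_{i}f(i)\pi_i$ for $f:\mathcal I\to\mathbb R$. Fix an initial distribution $\mu$ on $\mathcal I$. For a transition matrix (row-stochastic matrix) $Q$ on $\mathcal I$, let $X_0,X_1,\dots$ be the Markov chain with transition matrix $Q$ and $X_0\sim\mu$, and let $$\nu(f,Q,\pi)=\limsup_{n\to\infty}\; n\,\mathbb E_\mu\Big[\frac1n\sum_{k=0}^{n-1}f(X_k)-\pi(f)\Big]^2\in[0,\infty]$$ be its asymptotic variance. (If $Q$ is irreducible with invariant distribution $\pi$, this is a finite limit that does not depend on $\mu$.) Let $P=(p_{i,j})$ be an irreducible transition matrix that is reversible with respect to $\pi$, i.e. $\pi_i p_{i,j}=\pi_j p_{j,i}$ for all $i,j$. Suppose that at most one diagonal entry of $P$ is non-zero, and that the undirected graph on $\mathcal I$ in which distinct $i,j$ are joined if and only if $p_{i,j}>0$ is acyclic (so it is a tree). If $P'$ is any transition matrix on $\mathcal I$ with $\nu(f,P',\pi)\le\nu(f,P,\pi)$ for every $f:\mathcal I\to\mathbb R$, then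 $P'=P$. Consequently no transition matrix is uniformly better than $P$: there is no transition matrix $P'$ such that $\nu(f,P',\pi)\le\nu(f,P,\pi)$ for all $f$ and $\nu(f,P',\pi)<\nu(f,P,\pi)$ for at least one $f$. -/

import Mathlib

noncomputable section

namespace MarkovVar

/-- Law of the first `n + 1` states `X_0, …, X_n` of the Markov chain with initial distribution
`μ` and transition matrix `P`: the probability that the trajectory equals `x`. -/
def pathProb {I : Type*} (μ : I → ℝ) (P : Matrix I I ℝ) (n : ℕ) (x : Fin (n + 1) → I) : ℝ :=
  μ (x 0) * ∏ k : Fin n, P (x k.castSucc) (x k.succ)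

/-- The expectation `π(f) = ∑ i, f i * π i`. -/
def mean {I : Type*} [Fintype I] (π f : I → ℝ) : ℝ := ∑ i, f i * π i

/-- The mean squared error `E_μ [ (1/N) ∑_{k < N} f (X_k) - π(f) ]²` of the time average over
`N = n + 1` steps. -/
def meanSqError {I : Type*} [Fintype I] (μ π : I → ℝ) (P : Matrix I I ℝ) (f : I → ℝ) (n : ℕ) : ℝ :=
  ∑ x : Fin (n + 1) → I,
    pathProb μ P n x * ((1 / ((n : ℝ) + 1)) * (∑ k : Fin (n + 1), f (x k)) - mean π f) ^ 2

/-- The asymptotic variance `ν(f, P, π) = lim_N N * E_μ [ (1/N) ∑_{k < N} f (X_k) - π(f) ]²` of the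
chain started from `μ`. It is taken as an upper limit in `[0, ∞]`, so that it always has a
meaning (it is the limit whenever the limit exists, in particular for an irreducible `P` with
invariant distribution `π`, where it does not depend on `μ`; no junk value occurs). -/
def asymptoticVariance {I : Type*} [Fintype I] (μ : I → ℝ) (f : I → ℝ) (P : Matrix I I ℝ)
    (π : I → ℝ) : ENNReal :=
  Filter.limsup (fun n : ℕ => ENNReal.ofReal (((n : ℝ) + 1) * meanSqError μ π P f n)) Filter.atTop

/-- `P` is reversible with respect to `π` (detailed balance). -/
def IsReversible {I : Type*} (π : I → ℝ) (P : Matrix I I ℝ) : Prop :=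
  ∀ i j, π i * P i j = π j * P j i

/-- The undirected graph of `P`: distinct states `i`, `j` are joined when `P i j > 0` or
`P j i > 0` (for a reversible irreducible `P` the two are equivalent). Loops are not recorded,
since they are not cycles. -/
def transitionGraph {I : Type*} (P : Matrix I I ℝ) : SimpleGraph I :=
  SimpleGraph.fromRel (fun i j => 0 < P i j)

/-- `P'` is uniformly better than `P` (for chains started from `μ`). -/
def UniformlyBetter {I : Type*} [Fintype I] (μ π : I → ℝ) (P' P : Matrix I I ℝ) : Prop :=
  (∀ f : I → ℝ, asymptoticVariance μ f P' π ≤ asymptoticVariance μ f P π) ∧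
    ∃ f : I → ℝ, asymptoticVariance μ f P' π < asymptoticVariance μ f P π

end MarkovVar

end

/-! ### Laplacians of balanced flows -/

namespace MarkovVar

open Finset

variable {I : Type*} [Fintype I]

/-! Weighting rows by `π` turns a chain into a flow and `1 - P` into its Laplacian. If `f = (1 - P)
g + const`, a martingale argument gives the variance of `f` as `2 ⟨g, lap g⟩` minus a term
determined by `f` and `π` (`IsErgodicTo.tendsto_meanSqError`, `mean_sq_sub_eq`). A competitor with
finite variances must preserve `π` and be connected, so the claim is about balanced flows: if `lap F
g = lap G h` always forces energy `⟨g, lap F g⟩ ≤ ⟨h, lap G h⟩`, then `F = G`.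

Root the tree at `r`, the only state that may carry a loop. Indicators of the sides of edges span
all functions modulo constants, and `lap F = lap G` is proved on them from the leaves towards `r`
(`side_lap_eq`). Let `s` be the side of `xy` away from `r`, and solve `lap F g = lap G s`. Agreement
on smaller sides makes `g` constant on `s` and, as `G` has no loop at `x`, bounds the flow of `F`
from `x` out of `s` by `G x y`; so `g` drops by at least 1 from `x` to `y`. The energy bound says at
most 1. Equality there is an extremum, so the first variation vanishes: with `k` the solution for
the transposed flow, `g + k = 2 s` up to a constant. Both have range of length 1 and `s` takes
values 0 and 1, so both equal `s` up to constants. -/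

/-- The Laplacian `v ↦ (i ↦ ∑ j, F i j * (v i - v j))` of a (not necessarily symmetric) flow. -/
def lap (F : Matrix I I ℝ) : (I → ℝ) →ₗ[ℝ] (I → ℝ) where
  toFun v i := ∑ j, F i j * (v i - v j)
  map_add' u v := by
    ext i
    simp only [Pi.add_apply, ← sum_add_distrib]
    exact sum_congr rfl fun j _ => by ring
  map_smul' c v := by
    ext i
    simp only [Pi.smul_apply, smul_eq_mul, RingHom.id_apply, mul_sum]
    exact sum_congr rfl fun j _ => by ring

lemma lap_apply (F : Matrix I I ℝ) (v : I → ℝ) (i : I) :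
    lap F v i = ∑ j, F i j * (v i - v j) := rfl

/-- Inflow equals outflow at every vertex. -/
def IsBalanced (F : Matrix I I ℝ) : Prop := ∀ i, ∑ j, F i j = ∑ j, F j i

/-- Only constant functions have zero energy. -/
def IsConnected (F : Matrix I I ℝ) : Prop :=
  ∀ v : I → ℝ, v ⬝ᵥ lap F v = 0 → ∀ i j, v i = v j

lemma lap_const (F : Matrix I I ℝ) {v : I → ℝ} (hv : ∀ i j, v i = v j) : lap F v = 0 := by
  ext i
  simp [lap_apply, fun j => sub_eq_zero.2 (hv i j)]

lemma IsBalanced.transpose {F : Matrix I I ℝ} (hF : IsBalanced F) : IsBalanced F.transpose :=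
  fun i => (hF i).symm

/-- Time reversal: balance equates the diagonal parts of the two Laplacians, so transposing the flow
gives the adjoint. -/
lemma dotProduct_lap_comm {F : Matrix I I ℝ} (hF : IsBalanced F) (u v : I → ℝ) :
    u ⬝ᵥ lap F v = v ⬝ᵥ lap F.transpose u := by
  have h1 : u ⬝ᵥ lap F v = ∑ i, u i * v i * ∑ j, F i j - ∑ i, ∑ j, u i * F i j * v j := by
    simp only [dotProduct, lap_apply, mul_sum, ← sum_sub_distrib]
    exact sum_congr rfl fun i _ => sum_congr rfl fun j _ => by ring
  have h2 : v ⬝ᵥ lap F.transpose u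
      = ∑ i, u i * v i * ∑ j, F j i - ∑ i, ∑ j, u j * F j i * v i := by
    simp only [dotProduct, lap_apply, mul_sum, ← sum_sub_distrib, Matrix.transpose_apply]
    exact sum_congr rfl fun i _ => sum_congr rfl fun j _ => by ring
  rw [h1, h2, sum_comm (f := fun i j => u i * F i j * v j)]
  simp only [hF _]

lemma sum_lap {F : Matrix I I ℝ} (hF : IsBalanced F) (v : I → ℝ) : ∑ i, lap F v i = 0 := by
  have h := dotProduct_lap_comm hF (fun _ => 1) v
  rw [lap_const F.transpose (v := fun _ => 1) fun _ _ => rfl] at h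
  simpa [dotProduct] using h

lemma energy_eq {F : Matrix I I ℝ} (hF : IsBalanced F) (v : I → ℝ) :
    v ⬝ᵥ lap F v = 1 / 2 * ∑ i, ∑ j, F i j * (v i - v j) ^ 2 := by
  have h0 : ∑ i, ∑ j, F i j * v j ^ 2 = ∑ i, ∑ j, F i j * v i ^ 2 := by
    rw [sum_comm]
    simp only [← sum_mul, hF _]
  have h1 : v ⬝ᵥ lap F v = ∑ i, ∑ j, F i j * (v i - v j) ^ 2 / 2
      + 1 / 2 * (∑ i, ∑ j, F i j * v i ^ 2 - ∑ i, ∑ j, F i j * v j ^ 2) := by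
    simp only [dotProduct, lap_apply, mul_sum, ← sum_sub_distrib, ← sum_add_distrib]
    exact sum_congr rfl fun i _ => sum_congr rfl fun j _ => by ring
  rw [h1, h0, sub_self, mul_zero, add_zero, mul_sum]
  simp only [mul_sum]
  exact sum_congr rfl fun i _ => sum_congr rfl fun j _ => by ring

lemma energy_nonneg {F : Matrix I I ℝ} (hF : IsBalanced F) (hF0 : ∀ i j, 0 ≤ F i j)
    (v : I → ℝ) : 0 ≤ v ⬝ᵥ lap F v := by
  rw [energy_eq hF]
  have : ∀ i j, 0 ≤ F i j * (v i - v j) ^ 2 := fun i j => mul_nonneg (hF0 i j) (sq_nonneg _)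
  exact mul_nonneg (by norm_num) (sum_nonneg fun i _ => sum_nonneg fun j _ => this i j)

lemma eq_of_energy_eq_zero {F : Matrix I I ℝ} (hF : IsBalanced F) (hF0 : ∀ i j, 0 ≤ F i j)
    {v : I → ℝ} (hv : v ⬝ᵥ lap F v = 0) {i j : I} (hij : 0 < F i j) : v i = v j := by
  have h0 : ∀ i j, 0 ≤ F i j * (v i - v j) ^ 2 := fun i j => mul_nonneg (hF0 i j) (sq_nonneg _)
  rw [energy_eq hF, mul_eq_zero, or_iff_right (by norm_num),
    sum_eq_zero_iff_of_nonneg fun i _ => sum_nonneg fun j _ => h0 i j] at hv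
  have := (sum_eq_zero_iff_of_nonneg fun j _ => h0 i j).1 (hv i (mem_univ i)) j (mem_univ j)
  have := (mul_eq_zero.1 this).resolve_left hij.ne'
  exact sub_eq_zero.1 (pow_eq_zero_iff two_ne_zero |>.1 this)

lemma IsConnected.transpose {F : Matrix I I ℝ} (hF : IsBalanced F) (hc : IsConnected F) :
    IsConnected F.transpose := fun v hv => hc v (by rw [dotProduct_lap_comm hF, hv])

lemma IsConnected.of_lap_eq_zero {F : Matrix I I ℝ} (hc : IsConnected F) {v : I → ℝ}
    (hv : lap F v = 0) (i j : I) : v i = v j := hc v (by simp [hv]) i j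

/-- Adding the map `J`, which sends a function to its total, makes the Laplacian injective, hence
surjective; for a right side of sum zero the correction vanishes. -/
lemma exists_lap_eq {F : Matrix I I ℝ} (hF : IsBalanced F) (hc : IsConnected F) {f : I → ℝ}
    (hf : ∑ i, f i = 0) : ∃ g, lap F g = f := by
  cases isEmpty_or_nonempty I
  · exact ⟨0, Subsingleton.elim _ _⟩
  let J : (I → ℝ) →ₗ[ℝ] (I → ℝ) :=
    { toFun := fun v _ => ∑ j, v j
      map_add' := fun u v => by ext; simp [sum_add_distrib]
      map_smul' := fun c v => by ext; simp [mul_sum] }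
  have hJ : ∀ v i, J v i = ∑ j, v j := fun _ _ => rfl
  have key : ∀ v, ∑ i, (lap F + J) v i = 0 → ∑ j, v j = 0 := fun v hv => by
    simp only [LinearMap.add_apply, Pi.add_apply, sum_add_distrib, sum_lap hF, hJ, sum_const,
      zero_add, nsmul_eq_mul] at hv
    refine (mul_eq_zero.1 hv).resolve_left ?_
    simp
  have hinj : Function.Injective (lap F + J) := by
    rw [← LinearMap.ker_eq_bot, LinearMap.ker_eq_bot']
    intro v hv
    have hs := key v (by simp [hv])
    have hl : lap F v = 0 := by
      ext i
      have := congrFun hv i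
      simpa [hJ, hs] using this
    have hconst := hc.of_lap_eq_zero hl
    ext i
    have : ∑ j, v j = Fintype.card I * v i := by
      rw [sum_congr rfl fun j _ => hconst j i]; simp
    rw [hs] at this
    simpa using this.symm
  obtain ⟨g, hg⟩ := (LinearMap.injective_iff_surjective.1 hinj) f
  refine ⟨g, ?_⟩
  have hs := key g (by rw [hg, hf])
  ext i
  have := congrFun hg i
  simpa [hJ, hs] using this

/-- Maximum principle: testing against the positive part of `g - g x` shows that this part has zero
energy, so it is constant, and it vanishes at `x`. -/
lemma le_of_lap_nonpos {F : Matrix I I ℝ} (hF : IsBalanced F) (hF0 : ∀ i j, 0 ≤ F i j)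
    (hc : IsConnected F) {g : I → ℝ} {x : I} (hg : ∀ i, i ≠ x → lap F g i ≤ 0) (i : I) :
    g i ≤ g x := by
  set p : I → ℝ := fun i => max (g i - g x) 0 with hp
  have h1 : p ⬝ᵥ lap F g ≤ 0 := sum_nonpos fun i _ => by
    by_cases hi : i = x
    · simp [hp, hi]
    · exact mul_nonpos_of_nonneg_of_nonpos (le_max_right _ _) (hg i hi)
  have h2 : p ⬝ᵥ lap F p ≤ p ⬝ᵥ lap F g := by
    simp only [dotProduct, lap_apply, mul_sum]
    refine sum_le_sum fun i _ => sum_le_sum fun j _ => ?_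
    have : p i * (p i - p j) ≤ p i * (g i - g j) := by
      simp only [hp]
      rcases le_total (g i - g x) 0 with h | h
      · simp [max_eq_right h]
      · rw [max_eq_left h]
        exact mul_le_mul_of_nonneg_left (by linarith [le_max_left (g j - g x) 0]) h
    nlinarith [hF0 i j, mul_le_mul_of_nonneg_left this (hF0 i j)]
  have h3 := hc p (le_antisymm (h2.trans h1) (energy_nonneg hF hF0 p)) i x
  have h4 : g i - g x ≤ p i := le_max_left _ _
  rw [h3] at h4
  simp only [hp, sub_self, max_self] at h4
  linarith

end MarkovVar

/-! ### Edge cuts of a tree -/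

namespace MarkovVar

open Finset

variable {I : Type*}

/-- The indicator of the vertices that stay connected to `a` when the edge `ab` is removed. -/
noncomputable def side (T : SimpleGraph I) (a b : I) : I → ℝ :=
  Set.indicator {w | (T.deleteEdges {s(a, b)}).Reachable a w} 1

/-- A function which is constant along the edges of `T` is constant. -/
def EdgeConnected (T : SimpleGraph I) : Prop :=
  ∀ v : I → ℝ, (∀ i j, T.Adj i j → v i = v j) → ∀ i j, v i = v j

section side

variable {T : SimpleGraph I} {a b c d : I}

lemma side_eq_zero_or_one (T : SimpleGraph I) (a b i : I) : side T a b i = 0 ∨ side T a b i = 1 := by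
  by_cases h : (T.deleteEdges {s(a, b)}).Reachable a i
  · right; simp [side, h]
  · left; simp [side, h]

lemma side_left (T : SimpleGraph I) (a b : I) : side T a b a = 1 := by
  simp [side]

lemma side_right (hT : T.IsAcyclic) (h : T.Adj a b) : side T a b b = 0 := by
  have := SimpleGraph.isBridge_iff.1 (SimpleGraph.isAcyclic_iff_forall_adj_isBridge.1 hT h)
  simp [side, this]

lemma side_eq_of_adj (h : T.Adj c d) (hne : s(c, d) ≠ s(a, b)) : side T a b c = side T a b d := by
  have hadj : (T.deleteEdges {s(a, b)}).Adj c d := by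
    rw [SimpleGraph.deleteEdges_adj]
    exact ⟨h, hne⟩
  have : (T.deleteEdges {s(a, b)}).Reachable a c ↔ (T.deleteEdges {s(a, b)}).Reachable a d :=
    ⟨fun h => h.trans hadj.reachable, fun h => h.trans hadj.reachable.symm⟩
  by_cases hd : (T.deleteEdges {s(a, b)}).Reachable a d
  · simp [side, hd, this.2 hd]
  · simp [side, hd, this]

lemma side_add_swap (hT : T.IsAcyclic) (hc : EdgeConnected T) (h : T.Adj a b) (i : I) :
    side T a b i + side T b a i = 1 := by
  have := hc (fun i => side T a b i + side T b a i) (fun c d hcd => ?_) i a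
  · simpa [side_left, side_right hT h.symm] using this
  · by_cases he : s(c, d) = s(a, b)
    · rcases Sym2.eq_iff.1 he with ⟨rfl, rfl⟩ | ⟨rfl, rfl⟩ <;>
        simp [side_left, side_right hT h, side_right hT h.symm]
    · have he' : s(c, d) ≠ s(b, a) := by rwa [Sym2.eq_swap (a := b)]
      simp only [side_eq_of_adj hcd he, side_eq_of_adj hcd he']

/-- The sides of the edges of a tree span the functions modulo constants. -/
lemma mem_of_side_mem [Fintype I] (hT : T.IsAcyclic) (hc : EdgeConnected T) (W : Submodule ℝ (I → ℝ))
    (hW : (fun _ => 1) ∈ W) {v : I → ℝ}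
    (h : ∀ a b, T.Adj a b → v a ≠ v b → side T a b ∈ W) : v ∈ W := by
  classical
  -- Each edge occurs in both orientations, whence the factor 1/2. Only its own two sides jump
  -- across an edge.
  let k : I → I → ℝ := fun a b => if T.Adj a b then (v a - v b) / 2 else 0
  have hk : ∀ a b, T.Adj a b → k a b = (v a - v b) / 2 := fun a b h => if_pos h
  have hu : ∑ a, ∑ b, k a b • side T a b ∈ W := by
    refine W.sum_mem fun a _ => W.sum_mem fun b _ => ?_
    by_cases hab : T.Adj a b ∧ v a ≠ v b
    · exact W.smul_mem _ (h a b hab.1 hab.2)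
    · have : k a b = 0 := by
        by_cases hadj : T.Adj a b
        · rw [hk a b hadj, not_not.1 fun hne => hab ⟨hadj, hne⟩]; simp
        · exact if_neg hadj
      simp [this]
  set u := ∑ a, ∑ b, k a b • side T a b with hu_def
  have hua : ∀ i, u i = ∑ a, ∑ b, k a b * side T a b i := fun i => by
    simp [hu_def, Finset.sum_apply]
  have hdiff : ∀ c d, T.Adj c d → u c - u d = v c - v d := by
    intro c d hcd
    have hterm : ∀ a b, k a b * side T a b c - k a b * side T a b d
        = (if a = c then if b = d then (v c - v d) / 2 else 0 else 0)
          + (if a = d then if b = c then (v c - v d) / 2 else 0 else 0) := by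
      intro a b
      by_cases hadj : T.Adj a b
      · by_cases he : s(c, d) = s(a, b)
        · rcases Sym2.eq_iff.1 he with ⟨rfl, rfl⟩ | ⟨rfl, rfl⟩
          · simp [hk _ _ hadj, side_left, side_right hT hadj, hadj.ne]
          · simp [hk _ _ hadj, side_left, side_right hT hadj, hadj.ne]
            ring
        · rw [side_eq_of_adj hcd he, sub_self]
          have h1 : ¬ (a = c ∧ b = d) := by rintro ⟨rfl, rfl⟩; exact he rfl
          have h2 : ¬ (a = d ∧ b = c) := by rintro ⟨rfl, rfl⟩; exact he Sym2.eq_swap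
          simp only [← ite_and, if_neg h1, if_neg h2, add_zero]
      · have h1 : ¬ (a = c ∧ b = d) := by rintro ⟨rfl, rfl⟩; exact hadj hcd
        have h2 : ¬ (a = d ∧ b = c) := by rintro ⟨rfl, rfl⟩; exact hadj hcd.symm
        have h3 : k a b = 0 := if_neg hadj
        simp only [← ite_and, if_neg h1, if_neg h2, add_zero, h3, zero_mul, sub_zero]
    rw [hua, hua, ← sum_sub_distrib]
    simp only [← sum_sub_distrib, hterm, sum_add_distrib]
    simp [Finset.sum_ite_eq']
  cases isEmpty_or_nonempty I
  · rw [Subsingleton.elim v 0]; exact W.zero_mem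
  obtain ⟨o⟩ := ‹Nonempty I›
  have hconst := hc (fun i => v i - u i) fun c d hcd => by linarith [hdiff c d hcd]
  have : v = u + (v o - u o) • (fun _ => (1 : ℝ)) := by
    ext i
    simp only [Pi.add_apply, Pi.smul_apply, smul_eq_mul, mul_one]
    linarith [hconst i o]
  rw [this]
  exact W.add_mem hu (W.smul_mem _ hW)

/-- The product of one side with the complement of the other does not change along any edge, and it
vanishes at `a`. -/
lemma side_le_side (hT : T.IsAcyclic) (hc : EdgeConnected T) {x y : I}
    (hab : T.Adj a b) (ha : side T x y a = 1) (hb : side T x y b = 1)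
    (hy : side T a b y = 0) (hxy : T.Adj x y) (i : I) :
    side T a b i ≤ side T x y i := by
  have hne : s(x, y) ≠ s(a, b) := by
    intro he
    rcases Sym2.eq_iff.1 he with ⟨rfl, rfl⟩ | ⟨rfl, rfl⟩
    · simp [side_right hT hxy] at hb
    · simp [side_right hT hxy] at ha
  have := hc (fun i => side T a b i * (1 - side T x y i)) (fun c d hcd => ?_) i a
  · simp only [ha, sub_self, mul_zero] at this
    rcases side_eq_zero_or_one T x y i with h | h <;>
      rcases side_eq_zero_or_one T a b i with h' | h' <;> simp_all
  · by_cases he : s(c, d) = s(a, b)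
    · rcases Sym2.eq_iff.1 he with ⟨rfl, rfl⟩ | ⟨rfl, rfl⟩ <;> simp [ha, hb]
    · by_cases he' : s(c, d) = s(x, y)
      · have hx0 : side T a b x = 0 := by rw [side_eq_of_adj hxy hne, hy]
        rcases Sym2.eq_iff.1 he' with ⟨rfl, rfl⟩ | ⟨rfl, rfl⟩ <;> simp [hx0, hy]
      · simp only [side_eq_of_adj hcd he, side_eq_of_adj hcd he']

end side

/-! ### Rigidity of tree flows under energy domination -/

section flow

variable [Fintype I] {T : SimpleGraph I} {F G : Matrix I I ℝ}

/-- The indicator jumps across the single edge `xy`, so its Laplacian is a dipole of strength `G x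
y`. -/
lemma lap_side [DecidableEq I] (hT : T.IsAcyclic) (hG : ∀ i j, G i j = G j i)
    (hsupp : ∀ i j, i ≠ j → ¬ T.Adj i j → G i j = 0) {x y : I} (hxy : T.Adj x y) :
    lap G (side T x y) = Pi.single x (G x y) - Pi.single y (G x y) := by
  ext i
  have hterm : ∀ j, G i j * (side T x y i - side T x y j)
      = (if j = y then if i = x then G x y else 0 else 0)
        - (if j = x then if i = y then G x y else 0 else 0) := by
    intro j
    by_cases hij : T.Adj i j
    · by_cases he : s(i, j) = s(x, y)
      · rcases Sym2.eq_iff.1 he with ⟨rfl, rfl⟩ | ⟨rfl, rfl⟩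
        · simp [side_left, side_right hT hxy, hxy.ne]
        · simp [side_left, side_right hT hxy, hxy.ne, hG i j]
      · rw [side_eq_of_adj hij he, sub_self, mul_zero]
        have h1 : ¬ (j = y ∧ i = x) := by rintro ⟨rfl, rfl⟩; exact he rfl
        have h2 : ¬ (j = x ∧ i = y) := by rintro ⟨rfl, rfl⟩; exact he Sym2.eq_swap
        simp only [← ite_and, if_neg h1, if_neg h2, sub_zero]
    · have h1 : ¬ (j = y ∧ i = x) := by rintro ⟨rfl, rfl⟩; exact hij hxy
      have h2 : ¬ (j = x ∧ i = y) := by rintro ⟨rfl, rfl⟩; exact hij hxy.symm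
      simp only [← ite_and, if_neg h1, if_neg h2, sub_zero]
      by_cases hne : i = j
      · simp [hne]
      · simp [hsupp i j hne hij]
  rw [lap_apply, sum_congr rfl fun j _ => hterm j, sum_sub_distrib]
  simp [Finset.sum_ite_eq', Pi.single_apply]

lemma dotProduct_lap_side (hT : T.IsAcyclic) (hG : ∀ i j, G i j = G j i)
    (hsupp : ∀ i j, i ≠ j → ¬ T.Adj i j → G i j = 0) {x y : I} (hxy : T.Adj x y) (v : I → ℝ) :
    v ⬝ᵥ lap G (side T x y) = G x y * (v x - v y) := by
  classical
  rw [lap_side hT hG hsupp hxy, dotProduct_sub, dotProduct_single, dotProduct_single]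
  ring

/-- A solution of `lap F g = lap G (side T x y)` drops by at least one along the edge `xy`. -/
lemma one_le_sub_of_lap_eq [DecidableEq I] (hT : T.IsAcyclic) (hc : EdgeConnected T)
    (hG : ∀ i j, G i j = G j i) (hsupp : ∀ i j, i ≠ j → ¬ T.Adj i j → G i j = 0)
    (hF : IsBalanced F) (hF0 : ∀ i j, 0 ≤ F i j)
    (hFc : IsConnected F) (hFG : ∀ i, ∑ j, F i j = ∑ j, G i j) {x y : I} (hxy : T.Adj x y)
    (hpos : 0 < G x y) (hx : G x x = 0) {g : I → ℝ} (hg : lap F g = lap G (side T x y))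
    (hflat : ∀ a b, T.Adj a b → side T x y a = 1 → side T x y b = 1 → g a = g b)
    (hpunct : lap F (side T x y - Pi.single x 1) x = lap G (side T x y - Pi.single x 1) x) :
    (∀ i, g y ≤ g i ∧ g i ≤ g x) ∧ 1 ≤ g x - g y := by
  set s := side T x y with hs
  have hls := lap_side hT hG hsupp hxy
  have hle : ∀ i, g i ≤ g x := le_of_lap_nonpos hF hF0 hFc fun i hi => by
    rw [hg, hls]
    by_cases hiy : i = y
    · simp [hiy, hxy.ne', hpos.le]
    · simp [hi, hiy]
  have hge : ∀ i, g y ≤ g i := fun i => by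
    have := le_of_lap_nonpos hF hF0 hFc (g := -g) (x := y) (fun i hi => by
      rw [map_neg, hg, hls]
      by_cases hix : i = x
      · simp [hix, hxy.ne, hpos.le]
      · simp [hi, hix]) i
    simpa using this
  refine ⟨fun i => ⟨hge i, hle i⟩, ?_⟩
  have hsx : s x = 1 := side_left T x y
  have hsy : s y = 0 := side_right hT hxy
  have hconst : ∀ i, s i * (g i - g x) = 0 := fun i => by
    have := hc (fun i => s i * (g i - g x)) (fun a b hab => ?_) i x
    · simpa using this
    · by_cases he : s(a, b) = s(x, y)
      · rcases Sym2.eq_iff.1 he with ⟨rfl, rfl⟩ | ⟨rfl, rfl⟩ <;> simp [hsy]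
      · have h1 : s a = s b := side_eq_of_adj hab he
        rcases side_eq_zero_or_one T x y b with h | h
        · have h0 : s a = 0 := h1.trans h
          have h0' : s b = 0 := h
          simp only [h0, h0', zero_mul]
        · simp only [h1, hflat a b hab (h1.trans h) h]
  have hs01 : ∀ i, 0 ≤ 1 - s i := fun i => by
    rcases side_eq_zero_or_one T x y i with h | h <;> simp [hs, h]
  -- The source at `x` leaves only through targets outside the side, since `g` is flat inside; each
  -- such drop is at most `g x - g y`.
  have h1 : G x y ≤ (g x - g y) * ∑ w, F x w * (1 - s w) := by
    have : G x y = ∑ w, F x w * (1 - s w) * (g x - g w) := by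
      have h := congrFun hg x
      rw [hls, lap_apply] at h
      simp only [Pi.sub_apply, Pi.single_eq_same, Pi.single_eq_of_ne hxy.ne, sub_zero] at h
      rw [← h]
      refine sum_congr rfl fun w _ => ?_
      linear_combination (- F x w) * hconst w
    rw [this, mul_sum]
    refine sum_le_sum fun w _ => ?_
    rw [mul_comm (g x - g y)]
    exact mul_le_mul_of_nonneg_left (by linarith [hge w]) (mul_nonneg (hF0 _ _) (hs01 _))
  -- With equal row sums, `hpunct` reads: the flow of `F` out of the side plus `F x x` equals `G x y
  -- + G x x`, and `G x x = 0`.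
  have h2 : ∑ w, F x w * (1 - s w) ≤ G x y := by
    have hl : ∀ K : Matrix I I ℝ, lap K (s - Pi.single x 1) x
        = ∑ w, K x w * (1 - s w) - ∑ w, K x w + K x x := fun K => by
      have : K x x = ∑ w, K x w * (Pi.single x 1 : I → ℝ) w := by simp [Pi.single_apply]
      rw [lap_apply, this, ← sum_sub_distrib, ← sum_add_distrib]
      refine sum_congr rfl fun w _ => ?_
      simp only [Pi.sub_apply, hsx, Pi.single_eq_same]
      ring
    have hGs : ∑ w, G x w * (1 - s w) = G x y := by
      have h := congrFun hls x
      rw [lap_apply, side_left] at h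
      simpa [hxy.ne] using h
    rw [hl, hl, hFG x, hx, hGs] at hpunct
    linarith [hF0 x x]
  have h3 : 0 ≤ g x - g y := by linarith [hle y]
  have h4 := h1.trans (mul_le_mul_of_nonneg_left h2 h3)
  nlinarith

/-- If the energy of a balanced flow `F` is dominated by the one of a tree flow `G` (with loops at
most at `r`) in the dual sense, then `lap F` and `lap G` agree on the sides of all edges. -/
theorem side_lap_eq (hT : T.IsAcyclic) (hc : EdgeConnected T)
    (hG : ∀ i j, G i j = G j i) (hsupp : ∀ i j, i ≠ j → ¬ T.Adj i j → G i j = 0)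
    (hpos : ∀ i j, T.Adj i j → 0 < G i j) (hGc : IsConnected G)
    (hF : IsBalanced F) (hF0 : ∀ i j, 0 ≤ F i j)
    (hFc : IsConnected F) (hFG : ∀ i, ∑ j, F i j = ∑ j, G i j)
    (r : I) (hr : ∀ i, i ≠ r → G i i = 0)
    (hle : ∀ g h, lap F g = lap G h → g ⬝ᵥ lap F g ≤ h ⬝ᵥ lap G h)
    (x y : I) (hxy : T.Adj x y) (hxr : side T x y r = 0) :
    lap F (side T x y) = lap G (side T x y) ∧ lap F.transpose (side T x y) = lap G (side T x y) := by
  classical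
  have hGT : G.transpose = G := by ext i j; exact hG j i
  have hGb : IsBalanced G := fun i => sum_congr rfl fun j _ => hG i j
  have hcomm : ∀ u v, u ⬝ᵥ lap G v = v ⬝ᵥ lap G u := fun u v => by
    rw [dotProduct_lap_comm hGb, hGT]
  -- The transposed flow is carried along because flatness of a solution for `F` is tested through
  -- the transpose, and conversely.
  let W : Submodule ℝ (I → ℝ) := LinearMap.eqLocus (lap F) (lap G) ⊓
    LinearMap.eqLocus (lap F.transpose) (lap G)
  have hW1 : (fun _ => (1 : ℝ)) ∈ W := by
    constructor <;> simp [lap_const _ (v := fun _ : I => (1 : ℝ)) fun _ _ => rfl]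
  induction hn : #{i | side T x y i = 1} using Nat.strong_induction_on generalizing x y with
  | _ n ih =>
  set s := side T x y with hs
  have hsx : s x = 1 := side_left T x y
  have hsy : s y = 0 := side_right hT hxy
  -- A side avoiding `y` is nested in `s` and misses `b`, so it is strictly smaller and the
  -- induction applies.
  have hInner : ∀ a b, T.Adj a b → s a = 1 → s b = 1 → side T a b y = 0 → side T a b ∈ W := by
    intro a b hab ha hb hy
    have hsub := side_le_side hT hc hab ha hb hy hxy
    refine ih _ ?_ a b hab ?_ rfl
    · rw [← hn]
      refine card_lt_card ⟨fun i hi => ?_, fun h => ?_⟩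
      · simp only [mem_filter, mem_univ, true_and] at hi ⊢
        rcases side_eq_zero_or_one T x y i with h | h
        · linarith [hsub i]
        · exact h
      · have : b ∈ ({i | side T a b i = 1} : Finset I) := h (by simp [hb])
        simp [side_right hT hab] at this
    · rcases side_eq_zero_or_one T a b r with h | h
      · exact h
      · linarith [hsub r]
  have hInner' : ∀ a b, T.Adj a b → s a = 1 → s b = 1 → side T a b ∈ W := by
    intro a b hab ha hb
    rcases side_eq_zero_or_one T a b y with h | h
    · exact hInner a b hab ha hb h
    · have h' := hInner b a hab.symm hb ha (by linarith [side_add_swap hT hc hab y])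
      have : side T a b = (fun _ => 1) - side T b a := by
        ext i; simp only [Pi.sub_apply]; linarith [side_add_swap hT hc hab i]
      rw [this]
      exact W.sub_mem hW1 h'
  -- Removing `x` cancels the jump across `xy`; the remaining jumps are across edges inside the
  -- side.
  have hpunct : s - Pi.single x 1 ∈ W := by
    refine mem_of_side_mem hT hc W hW1 fun a b hab hne => ?_
    by_cases he : s(a, b) = s(x, y)
    · exfalso
      rcases Sym2.eq_iff.1 he with ⟨rfl, rfl⟩ | ⟨rfl, rfl⟩ <;>
        simp [hsx, hsy, hxy.ne'] at hne
    · have h1 : s a = s b := side_eq_of_adj hab he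
      rcases side_eq_zero_or_one T x y b with h | h
      · exfalso
        have hb : b ≠ x := by rintro rfl; rw [← hs, hsx] at h; norm_num at h
        have ha : a ≠ x := by rintro rfl; rw [← hs, ← h1, hsx] at h; norm_num at h
        simp [h1, ha, hb] at hne
      · exact hInner' a b hab (h1.trans h) h
  have hxr' : G x x = 0 := hr x (by rintro rfl; rw [hsx] at hxr; norm_num at hxr)
  -- Pairing with the side of an inner edge `ab` measures the drop of `g` across `ab`; the source
  -- and sink of `lap G s` lie on the same side of `ab`, so the drop is zero.
  have hflat : ∀ K : Matrix I I ℝ, IsBalanced K → (∀ v ∈ W, lap K.transpose v = lap G v) →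
      ∀ g, lap K g = lap G s → ∀ a b, T.Adj a b → s a = 1 → s b = 1 → g a = g b := by
    intro K hK hKW g hg a b hab ha hb
    have hne : s(x, y) ≠ s(a, b) := by
      intro he
      rcases Sym2.eq_iff.1 he with ⟨rfl, rfl⟩ | ⟨rfl, rfl⟩
      · simp [hsy] at hb
      · simp [hsy] at ha
    have h1 : side T a b ⬝ᵥ lap K g = G a b * (g a - g b) := by
      rw [dotProduct_lap_comm hK, hKW _ (hInner' a b hab ha hb),
        dotProduct_lap_side hT hG hsupp hab]
    rw [hg, dotProduct_lap_side hT hG hsupp hxy, side_eq_of_adj hxy hne, sub_self, mul_zero] at h1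
    have := (mul_eq_zero.1 h1.symm).resolve_left (hpos a b hab).ne'
    linarith
  obtain ⟨g, hg⟩ := exists_lap_eq hF hFc (sum_lap hGb s)
  obtain ⟨k, hk⟩ := exists_lap_eq hF.transpose (hFc.transpose hF) (sum_lap hGb s)
  obtain ⟨hgb, hg1⟩ := one_le_sub_of_lap_eq hT hc hG hsupp hF hF0 hFc hFG hxy (hpos x y hxy) hxr' hg
    (hflat F hF (fun v hv => hv.2) g hg) (congrFun hpunct.1 x)
  obtain ⟨hkb, hk1⟩ := one_le_sub_of_lap_eq hT hc hG hsupp hF.transpose (fun i j => hF0 j i)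
    (hFc.transpose hF) (fun i => (hF i).symm.trans (hFG i)) hxy (hpos x y hxy) hxr' hk
    (hflat F.transpose hF.transpose (fun v hv => hv.1) k hk) (congrFun hpunct.2 x)
  have hdrop : ∀ v, v ⬝ᵥ lap G s = G x y * (v x - v y) := dotProduct_lap_side hT hG hsupp hxy
  have hgx : g x - g y = 1 := by
    have := hle g s hg
    rw [hg, hdrop, hdrop, hsx, hsy] at this
    nlinarith [hpos x y hxy]
  have hkx : k x - k y = 1 := by
    have : k ⬝ᵥ lap G s = g ⬝ᵥ lap G s := by
      nth_rewrite 1 [← hg]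
      rw [dotProduct_lap_comm hF, hk]
    rw [hdrop, hdrop, hgx] at this
    exact mul_left_cancel₀ (hpos x y hxy).ne' this
  -- The energy inequality at `s + t • h` is an equality at `t = 0`, so its linear term in `t`
  -- vanishes.
  have hcross : ∀ h, h ⬝ᵥ lap G ((2 : ℝ) • s - g - k) = 0 := by
    intro h
    obtain ⟨g', hg'⟩ := exists_lap_eq hF hFc (sum_lap hGb h)
    have e1 : g' ⬝ᵥ lap G s = h ⬝ᵥ lap G k := by
      rw [← hk, dotProduct_lap_comm hF.transpose, Matrix.transpose_transpose, hg', hcomm]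
    have e2 : g ⬝ᵥ lap G h = h ⬝ᵥ lap G g := hcomm _ _
    have e3 : s ⬝ᵥ lap G h = h ⬝ᵥ lap G s := hcomm _ _
    have e4 : g ⬝ᵥ lap G s = s ⬝ᵥ lap G s := by rw [hdrop, hdrop, hgx, hsx, hsy]; ring
    have hquad : ∀ t : ℝ, 0 ≤ (h ⬝ᵥ lap G h - g' ⬝ᵥ lap G h) * (t * t)
        + (h ⬝ᵥ lap G ((2 : ℝ) • s - g - k)) * t + 0 := by
      intro t
      have hgt : lap F (g + t • g') = lap G (s + t • h) := by
        rw [map_add, map_add, map_smul, map_smul, hg, hg']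
      have := hle _ _ hgt
      rw [hgt] at this
      simp only [map_add, map_sub, map_smul, dotProduct_add, add_dotProduct,
        dotProduct_sub, dotProduct_smul, smul_dotProduct, smul_eq_mul,
        e1, e2, e3, e4] at this ⊢
      linarith
    have := discrim_le_zero hquad
    rw [discrim, mul_zero, sub_zero] at this
    exact pow_eq_zero_iff two_ne_zero |>.1 (le_antisymm this (sq_nonneg _))
  have hconst := hGc _ (hcross ((2 : ℝ) • s - g - k))
  -- Two numbers in `[0, 1]` with sum 0 or 2 are both extreme.
  have hboth : ∀ i, g i - g y = s i ∧ k i - k y = s i := by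
    intro i
    have h1 := hconst i y
    simp only [Pi.sub_apply, Pi.smul_apply, smul_eq_mul, hsy] at h1
    have h2 := hgb i
    have h3 := hkb i
    rcases side_eq_zero_or_one T x y i with h | h <;> rw [← hs] at h <;> rw [h] at h1 ⊢ <;>
      constructor <;> linarith
  have hgs : g = s + fun _ => g y := by ext i; simp only [Pi.add_apply]; linarith [(hboth i).1]
  have hks : k = s + fun _ => k y := by ext i; simp only [Pi.add_apply]; linarith [(hboth i).2]
  constructor
  · rw [hgs, map_add, lap_const F (v := fun _ => g y) fun _ _ => rfl, add_zero] at hg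
    exact hg
  · rw [hks, map_add, lap_const F.transpose (v := fun _ => k y) fun _ _ => rfl, add_zero] at hk
    exact hk

/-- Sides span, so the Laplacians coincide. Laplacians do not see loops; equal row sums recover the
diagonal. -/
theorem eq_of_energy_le (hT : T.IsAcyclic) (hc : EdgeConnected T)
    (hG : ∀ i j, G i j = G j i) (hsupp : ∀ i j, i ≠ j → ¬ T.Adj i j → G i j = 0)
    (hpos : ∀ i j, T.Adj i j → 0 < G i j) (hGc : IsConnected G)
    (hF : IsBalanced F) (hF0 : ∀ i j, 0 ≤ F i j)
    (hFc : IsConnected F) (hFG : ∀ i, ∑ j, F i j = ∑ j, G i j)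
    (r : I) (hr : ∀ i, i ≠ r → G i i = 0)
    (hle : ∀ g h, lap F g = lap G h → g ⬝ᵥ lap F g ≤ h ⬝ᵥ lap G h) : F = G := by
  classical
  let W := LinearMap.eqLocus (lap F) (lap G)
  have hW1 : (fun _ => (1 : ℝ)) ∈ W := by
    simp [W, lap_const _ (v := fun _ : I => (1 : ℝ)) fun _ _ => rfl]
  have hW : ∀ v, v ∈ W := fun v => mem_of_side_mem hT hc W hW1 fun a b hab _ => by
    have key := side_lap_eq hT hc hG hsupp hpos hGc hF hF0 hFc hFG r hr hle
    rcases side_eq_zero_or_one T a b r with h | h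
    · exact (key a b hab h).1
    · have h' := (key b a hab.symm (by linarith [side_add_swap hT hc hab r])).1
      have : side T a b = (fun _ => 1) - side T b a := by
        ext i; simp only [Pi.sub_apply]; linarith [side_add_swap hT hc hab i]
      rw [this]
      exact W.sub_mem hW1 h'
  have hl : ∀ (K : Matrix I I ℝ) i j, lap K (Pi.single j 1) i
      = (∑ w, K i w) * (Pi.single j 1 : I → ℝ) i - K i j := fun K i j => by
    have : K i j = ∑ w, K i w * (Pi.single j 1 : I → ℝ) w := by simp [Pi.single_apply]
    rw [lap_apply, this, sum_mul, ← sum_sub_distrib]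
    exact sum_congr rfl fun w _ => by ring
  ext i j
  have := congrFun (hW (Pi.single j 1)) i
  rw [hl, hl, hFG] at this
  linarith

end flow

end MarkovVar

/-! ### Expectations along trajectories -/

namespace MarkovVar

open Finset Filter Topology

variable {I : Type*} [Fintype I]

section expectation

/-- The expectation of a functional of the first `n + 1` states. -/
noncomputable def expect (μ : I → ℝ) (P : Matrix I I ℝ) (n : ℕ) (F : (Fin (n + 1) → I) → ℝ) : ℝ :=
  ∑ x, pathProb μ P n x * F x

/-- The expectation of `f (X_n)`. -/
noncomputable def marginal (μ : I → ℝ) (P : Matrix I I ℝ) (n : ℕ) (f : I → ℝ) : ℝ :=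
  expect μ P n fun x => f (x (Fin.last n))

variable {μ : I → ℝ} {P : Matrix I I ℝ}

omit [Fintype I] in
lemma pathProb_snoc (μ : I → ℝ) (P : Matrix I I ℝ) (n : ℕ) (x : Fin (n + 1) → I) (j : I) :
    pathProb μ P (n + 1) (Fin.snoc x j : Fin (n + 2) → I)
      = pathProb μ P n x * P (x (Fin.last n)) j := by
  unfold pathProb
  rw [Fin.prod_univ_castSucc, ← mul_assoc]
  have h0 : (Fin.snoc x j : Fin (n + 2) → I) 0 = x 0 := Fin.snoc_castSucc (α := fun _ => I) j x 0
  have h1 : ∀ k : Fin (n + 1), (Fin.snoc x j : Fin (n + 2) → I) k.castSucc = x k :=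
    fun k => Fin.snoc_castSucc (α := fun _ => I) j x k
  have h2 : ∀ k : Fin n, (Fin.snoc x j : Fin (n + 2) → I) k.castSucc.succ = x k.succ := fun k => by
    rw [Fin.succ_castSucc, h1]
  have h3 : (Fin.snoc x j : Fin (n + 2) → I) (Fin.last n).succ = j := by
    rw [Fin.succ_last]; exact Fin.snoc_last (α := fun _ => I) j x
  simp only [h0, h1, h2, h3]

/-- The Markov property: condition on the first `n + 1` states. -/
lemma expect_succ (μ : I → ℝ) (P : Matrix I I ℝ) (n : ℕ) (F : (Fin (n + 2) → I) → ℝ) :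
    expect μ P (n + 1) F
      = expect μ P n fun x => ∑ j, P (x (Fin.last n)) j * F (Fin.snoc x j : Fin (n + 2) → I) := by
  unfold expect
  rw [← Fintype.sum_equiv (Fin.snocEquiv fun _ : Fin (n + 2) => I)
    (fun p : I × (Fin (n + 1) → I) => pathProb μ P (n + 1) (Fin.snoc p.2 p.1 : Fin (n + 2) → I)
      * F (Fin.snoc p.2 p.1 : Fin (n + 2) → I)) _ (fun p => rfl), Fintype.sum_prod_type,
    sum_comm]
  refine sum_congr rfl fun x _ => ?_
  rw [mul_sum]
  exact sum_congr rfl fun j _ => by rw [pathProb_snoc, mul_assoc]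

lemma expect_zero (μ : I → ℝ) (P : Matrix I I ℝ) (F : (Fin 1 → I) → ℝ) :
    expect μ P 0 F = ∑ i, μ i * F fun _ => i := by
  unfold expect pathProb
  rw [← Fintype.sum_equiv (Equiv.funUnique (Fin 1) I).symm
    (fun i => μ i * F fun _ => i) _ (fun i => ?_)]
  simp only [univ_eq_empty, prod_empty, mul_one]
  rfl

lemma expect_add (n : ℕ) (F H : (Fin (n + 1) → I) → ℝ) :
    expect μ P n (fun x => F x + H x) = expect μ P n F + expect μ P n H := by
  simp only [expect, mul_add, sum_add_distrib]

lemma expect_const_mul (n : ℕ) (c : ℝ) (F : (Fin (n + 1) → I) → ℝ) :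
    expect μ P n (fun x => c * F x) = c * expect μ P n F := by
  simp only [expect, mul_sum]
  exact sum_congr rfl fun _ _ => by ring

lemma expect_sub (n : ℕ) (F H : (Fin (n + 1) → I) → ℝ) :
    expect μ P n (fun x => F x - H x) = expect μ P n F - expect μ P n H := by
  simp only [expect, mul_sub, sum_sub_distrib]

variable (hμ : μ ∈ stdSimplex ℝ I) (hP0 : ∀ i j, 0 ≤ P i j) (hP1 : ∀ i, ∑ j, P i j = 1)

include hμ hP0 in
lemma expect_mono {n : ℕ} {F H : (Fin (n + 1) → I) → ℝ} (h : ∀ x, F x ≤ H x) :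
    expect μ P n F ≤ expect μ P n H :=
  sum_le_sum fun x _ => mul_le_mul_of_nonneg_left (h x)
    (mul_nonneg (hμ.1 _) (prod_nonneg fun _ _ => hP0 _ _))

include hμ hP1 in
lemma expect_const (n : ℕ) (c : ℝ) : expect μ P n (fun _ => c) = c := by
  induction n with
  | zero => rw [expect_zero, ← sum_mul, hμ.2, one_mul]
  | succ n ih =>
    rw [expect_succ]
    simpa only [← sum_mul, hP1, one_mul] using ih

lemma marginal_succ (n : ℕ) (f : I → ℝ) :
    marginal μ P (n + 1) f = marginal μ P n (P.mulVec f) := by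
  unfold marginal
  rw [expect_succ]
  simp only [Fin.snoc_last (α := fun _ => I)]
  rfl

include hμ hP0 hP1 in
lemma abs_marginal_le (n : ℕ) (f : I → ℝ) : |marginal μ P n f| ≤ ∑ i, |f i| := by
  have h : ∀ i, |f i| ≤ ∑ i, |f i| := fun i =>
    single_le_sum (f := fun i => |f i|) (fun _ _ => abs_nonneg _) (mem_univ i)
  rw [abs_le]
  constructor
  · rw [← expect_const hμ hP1 n (-∑ i, |f i|)]
    exact expect_mono hμ hP0 fun x => (abs_le.1 (h _)).1
  · conv_rhs => rw [← expect_const hμ hP1 n (∑ i, |f i|)]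
    exact expect_mono hμ hP0 fun x => (abs_le.1 (h _)).2

include hP1 in
lemma expect_sum (n : ℕ) (f : I → ℝ) :
    expect μ P n (fun x => ∑ k, f (x k)) = ∑ k ∈ range (n + 1), marginal μ P k f := by
  induction n with
  | zero => simp [marginal]
  | succ n ih =>
    rw [sum_range_succ, ← ih, marginal_succ, expect_succ, marginal, ← expect_add]
    congr 1
    ext x
    have : ∀ j, ∑ k, f ((Fin.snoc x j : Fin (n + 2) → I) k) = ∑ k, f (x k) + f j := fun j => by
      rw [Fin.sum_univ_castSucc]
      simp only [Fin.snoc_last (α := fun _ => I), Fin.snoc_castSucc (α := fun _ => I)]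
    simp only [this, mul_add, sum_add_distrib, ← sum_mul, hP1, one_mul]
    rfl

lemma meanSqError_eq_expect (π f : I → ℝ) (n : ℕ) : meanSqError μ π P f n
    = expect μ P n fun x => (1 / ((n : ℝ) + 1) * (∑ k, f (x k)) - mean π f) ^ 2 := rfl

include hμ hP0 hP1 in
lemma sq_expect_le (n : ℕ) (F : (Fin (n + 1) → I) → ℝ) :
    expect μ P n F ^ 2 ≤ expect μ P n fun x => F x ^ 2 := by
  have h : 0 ≤ expect μ P n fun x => (F x - expect μ P n F) ^ 2 := by
    rw [← expect_const hμ hP1 n 0]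
    exact expect_mono hμ hP0 fun x => sq_nonneg _
  have h2 : (fun x => (F x - expect μ P n F) ^ 2)
      = fun x => (F x ^ 2 - (2 * expect μ P n F) * F x) + expect μ P n F ^ 2 := by
    ext x; ring
  rw [h2, expect_add, expect_sub, expect_const_mul, expect_const hμ hP1] at h
  linarith

end expectation

/-! ### Ergodic averages and the asymptotic variance -/

section asymptotics

/-- The Cesàro means of the laws of the `X_k` converge to `π`. -/
def IsErgodicTo (μ : I → ℝ) (P : Matrix I I ℝ) (π : I → ℝ) : Prop :=
  ∀ f : I → ℝ, Tendsto (fun n : ℕ => (∑ k ∈ range (n + 1), marginal μ P k f) / ((n : ℝ) + 1))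
    atTop (𝓝 (mean π f))

variable {μ π : I → ℝ} {P : Matrix I I ℝ}

lemma tendsto_div_succ_of_abs_le {u : ℕ → ℝ} {C : ℝ} (hu : ∀ n, |u n| ≤ C) :
    Tendsto (fun n : ℕ => u n / ((n : ℝ) + 1)) atTop (𝓝 0) := by
  have h : Tendsto (fun n : ℕ => C / ((n : ℝ) + 1)) atTop (𝓝 0) :=
    tendsto_const_nhds.div_atTop (tendsto_atTop_add_const_right _ _ tendsto_natCast_atTop_atTop)
  refine squeeze_zero_norm (fun n => ?_) h
  have : (0 : ℝ) < n + 1 := by positivity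
  rw [Real.norm_eq_abs, abs_div, abs_of_pos this]
  exact div_le_div_of_nonneg_right (hu n) this.le

variable (hμ : μ ∈ stdSimplex ℝ I) (hP0 : ∀ i j, 0 ≤ P i j) (hP1 : ∀ i, ∑ j, P i j = 1)

include hμ hP0 hP1

/-- The Cesàro sums of `f` and `P.mulVec f` differ by two bounded boundary terms, so `π` is
invariant. -/
lemma IsErgodicTo.mean_mulVec (h : IsErgodicTo μ P π) (f : I → ℝ) :
    mean π (P.mulVec f) = mean π f := by
  have h1 := h (P.mulVec f)
  have h2 := (h f).add (tendsto_div_succ_of_abs_le (C := ∑ i, |f i| + ∑ i, |f i|)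
    (u := fun n => marginal μ P (n + 1) f - marginal μ P 0 f) fun n =>
      (abs_sub _ _).trans (add_le_add (abs_marginal_le hμ hP0 hP1 _ _)
        (abs_marginal_le hμ hP0 hP1 _ _)))
  rw [add_zero] at h2
  refine tendsto_nhds_unique h1 (h2.congr fun n => ?_)
  rw [← add_div]
  congr 1
  simp only [← marginal_succ]
  rw [add_sub, ← sum_range_succ, sum_range_succ' _ (n + 1)]
  ring

lemma isErgodicTo_of_poisson
    (h : ∀ f : I → ℝ, ∃ g : I → ℝ, ∀ i, f i = g i - P.mulVec g i + mean π f) :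
    IsErgodicTo μ P π := by
  intro f
  obtain ⟨g, hg⟩ := h f
  have h2 := (tendsto_const_nhds (x := mean π f)).add
    (tendsto_div_succ_of_abs_le (C := ∑ i, |g i| + ∑ i, |g i|)
    (u := fun n => marginal μ P 0 g - marginal μ P (n + 1) g) fun n =>
      (abs_sub _ _).trans (add_le_add (abs_marginal_le hμ hP0 hP1 _ _)
        (abs_marginal_le hμ hP0 hP1 _ _)))
  rw [add_zero] at h2
  refine h2.congr fun n => ?_
  have hk : ∀ k, marginal μ P k f = marginal μ P k g - marginal μ P (k + 1) g + mean π f := by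
    intro k
    rw [marginal_succ, marginal, marginal, marginal, ← expect_sub,
      ← expect_const hμ hP1 k (mean π f), ← expect_add]
    congr 1
    ext x
    exact hg _
  have hn : (n : ℝ) + 1 ≠ 0 := by positivity
  simp only [hk, sum_add_distrib, sum_range_sub', sum_const, card_range, nsmul_eq_mul]
  push_cast
  field_simp
  ring

-- The sum rearranges to `g (X_0)` plus the martingale increments `g (X_(k+1)) - (P g) (X_k)`; these
-- are orthogonal, and their conditional variances are the summands on the right.
omit hμ hP0 in
lemma expect_martingale_sq (g : I → ℝ) (n : ℕ) :
    expect μ P n (fun x => (∑ k, (g - P.mulVec g) (x k) + P.mulVec g (x (Fin.last n))) ^ 2)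
      = marginal μ P 0 (g ^ 2)
        + ∑ k ∈ range n, marginal μ P k (P.mulVec (g ^ 2) - (P.mulVec g) ^ 2) := by
  induction n with
  | zero => simp [marginal]
  | succ n ih =>
    rw [sum_range_succ, ← add_assoc, ← ih, expect_succ, marginal, ← expect_add]
    congr 1
    ext x
    have : ∀ j, P (x (Fin.last n)) j * (∑ k, (g - P.mulVec g) ((Fin.snoc x j : Fin (n + 2) → I) k)
        + P.mulVec g ((Fin.snoc x j : Fin (n + 2) → I) (Fin.last (n + 1)))) ^ 2
        = (∑ k, (g - P.mulVec g) (x k)) ^ 2 * P (x (Fin.last n)) j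
          + 2 * (∑ k, (g - P.mulVec g) (x k)) * (P (x (Fin.last n)) j * g j)
          + P (x (Fin.last n)) j * (g ^ 2) j := fun j => by
      rw [Fin.sum_univ_castSucc]
      simp only [Fin.snoc_last (α := fun _ => I), Fin.snoc_castSucc (α := fun _ => I)]
      simp only [Pi.sub_apply, Pi.pow_apply]
      ring
    simp only [this, sum_add_distrib, ← mul_sum, hP1]
    change _ + _ * P.mulVec g (x (Fin.last n)) + P.mulVec (g ^ 2) (x (Fin.last n)) = _
    simp only [Pi.sub_apply, Pi.pow_apply]
    ring

/-- The asymptotic variance of `(1 - P) g` up to constants. -/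
theorem IsErgodicTo.tendsto_meanSqError (h : IsErgodicTo μ P π) (hπ : ∑ i, π i = 1)
    {f g : I → ℝ} {m : ℝ} (hf : ∀ i, f i = g i - P.mulVec g i + m) :
    Tendsto (fun n : ℕ => ((n : ℝ) + 1) * meanSqError μ π P f n) atTop
      (𝓝 (mean π (g ^ 2) - mean π ((P.mulVec g) ^ 2))) := by
  have hm : mean π f = m := by
    have : mean π f = mean π g - mean π (P.mulVec g) + m := by
      simp only [mean, hf, add_mul, sub_mul, sum_add_distrib, sum_sub_distrib, ← mul_sum, hπ,
        mul_one]
    rw [this, h.mean_mulVec hμ hP0 hP1, sub_self, zero_add]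
  set φ := P.mulVec (g ^ 2) - (P.mulVec g) ^ 2 with hφ
  have hφm : mean π φ = mean π (g ^ 2) - mean π ((P.mulVec g) ^ 2) := by
    rw [← h.mean_mulVec hμ hP0 hP1 (g ^ 2)]
    simp only [mean, hφ, Pi.sub_apply, sub_mul, sum_sub_distrib]
  set Y : ℕ → ℝ := fun n =>
    expect μ P n (fun x => (∑ k, (g - P.mulVec g) (x k) + P.mulVec g (x (Fin.last n))) ^ 2)
    with hY
  have hYlim : Tendsto (fun n : ℕ => Y n / ((n : ℝ) + 1)) atTop (𝓝 (mean π φ)) := by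
    have h2 := (h φ).add (tendsto_div_succ_of_abs_le (C := ∑ i, |(g ^ 2) i| + ∑ i, |φ i|)
      (u := fun n => marginal μ P 0 (g ^ 2) - marginal μ P n φ) fun n =>
        (abs_sub _ _).trans (add_le_add (abs_marginal_le hμ hP0 hP1 _ _)
          (abs_marginal_le hμ hP0 hP1 _ _)))
    rw [add_zero] at h2
    refine h2.congr fun n => ?_
    rw [← add_div, hY]
    simp only [expect_martingale_sq hP1, sum_range_succ, ← hφ]
    ring
  set C := ∑ i, |P.mulVec g i| with hC
  have hCle : ∀ i, P.mulVec g i ^ 2 ≤ C ^ 2 := fun i => by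
    rw [← sq_abs]
    exact pow_le_pow_left₀ (abs_nonneg _)
      (single_le_sum (f := fun i => |P.mulVec g i|) (fun _ _ => abs_nonneg _) (mem_univ i)) 2
  have hrinv : Tendsto (fun n : ℕ => (√((n : ℝ) + 1))⁻¹) atTop (𝓝 0) :=
    (Real.tendsto_sqrt_atTop.comp (tendsto_atTop_add_const_right _ _
      tendsto_natCast_atTop_atTop)).inv_tendsto_atTop
  have hMS : ∀ n : ℕ, ((n : ℝ) + 1) * meanSqError μ π P f n
      = expect μ P n (fun x => (∑ k, (g - P.mulVec g) (x k)) ^ 2) / ((n : ℝ) + 1) := by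
    intro n
    have hn : (n : ℝ) + 1 ≠ 0 := by positivity
    rw [meanSqError_eq_expect, hm, one_div, div_eq_inv_mul, ← expect_const_mul, ← expect_const_mul]
    congr 1
    ext x
    simp only [hf, sum_add_distrib, sum_const, card_univ, Fintype.card_fin, nsmul_eq_mul,
      Pi.sub_apply]
    push_cast
    field_simp
    ring
  have hdiff : ∀ n : ℕ, |expect μ P n (fun x => (∑ k, (g - P.mulVec g) (x k)) ^ 2) / ((n : ℝ) + 1)
      - Y n / ((n : ℝ) + 1)|
      ≤ (Y n / ((n : ℝ) + 1)) * (√((n : ℝ) + 1))⁻¹ + 2 * C ^ 2 * (√((n : ℝ) + 1))⁻¹ := by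
    intro n
    set r := √((n : ℝ) + 1) with hr
    have hr1 : 1 ≤ r := Real.one_le_sqrt.2 (by linarith [n.cast_nonneg (α := ℝ)])
    have hr0 : 0 < r := by linarith
    have hr2 : (n : ℝ) + 1 = r ^ 2 := (Real.sq_sqrt (by positivity)).symm
    -- Dropping the bounded boundary term `c` costs a cross term, split by Young's inequality with
    -- weight `r = √(n + 1)` so that both pieces are negligible after division by `n + 1`.
    have hp : ∀ s c : ℝ, c ^ 2 ≤ C ^ 2 → |s ^ 2 - (s + c) ^ 2| ≤ r⁻¹ * (s + c) ^ 2 + 2 * C ^ 2 * r := by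
      intro s c hc
      have e : r⁻¹ * (s + c) ^ 2 + c ^ 2 * r - 2 * (s + c) * c = r⁻¹ * (s + c - c * r) ^ 2 := by
        field_simp
        ring
      have e' : r⁻¹ * (s + c) ^ 2 + c ^ 2 * r + 2 * (s + c) * c = r⁻¹ * (s + c + c * r) ^ 2 := by
        field_simp
        ring
      have e1 : 0 ≤ r⁻¹ * (s + c - c * r) ^ 2 := by positivity
      have e2 : 0 ≤ r⁻¹ * (s + c + c * r) ^ 2 := by positivity
      have e3 : c ^ 2 * r ≤ C ^ 2 * r := mul_le_mul_of_nonneg_right hc hr0.le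
      have e4 : c ^ 2 ≤ C ^ 2 * r := hc.trans (le_mul_of_one_le_right (sq_nonneg _) hr1)
      rw [abs_le]
      constructor <;> nlinarith
    have hE : |expect μ P n (fun x => (∑ k, (g - P.mulVec g) (x k)) ^ 2) - Y n|
        ≤ r⁻¹ * Y n + 2 * C ^ 2 * r := by
      rw [hY]
      simp only
      rw [← expect_sub, ← expect_const_mul]
      conv_rhs => rw [← expect_const hμ hP1 n (2 * C ^ 2 * r), ← expect_add]
      rw [abs_le]
      constructor
      · rw [← neg_one_mul, ← expect_const_mul]
        refine expect_mono hμ hP0 fun x => ?_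
        linarith [(abs_le.1 (hp (∑ k, (g - P.mulVec g) (x k)) _ (hCle (x (Fin.last n))))).1]
      · exact expect_mono hμ hP0 fun x => (abs_le.1 (hp _ _ (hCle _))).2
    rw [← sub_div, abs_div, hr2, abs_of_pos (by positivity : 0 < r ^ 2),
      div_le_iff₀ (by positivity)]
    refine hE.trans (le_of_eq ?_)
    field_simp
  have hb : Tendsto (fun n : ℕ => (Y n / ((n : ℝ) + 1)) * (√((n : ℝ) + 1))⁻¹
      + 2 * C ^ 2 * (√((n : ℝ) + 1))⁻¹) atTop (𝓝 0) := by
    simpa using (hYlim.mul hrinv).add (hrinv.const_mul (2 * C ^ 2))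
  have h0 := squeeze_zero_norm (fun n => (Real.norm_eq_abs _).trans_le (hdiff n)) hb
  rw [← hφm]
  simpa [hMS] using h0.add hYlim

/-- Nonnegativity is recorded so that comparisons of `ENNReal.ofReal` values can be read back in the
reals. -/
theorem IsErgodicTo.asymptoticVariance_eq (h : IsErgodicTo μ P π) (hπ : ∑ i, π i = 1)
    {f g : I → ℝ} {m : ℝ} (hf : ∀ i, f i = g i - P.mulVec g i + m) :
    0 ≤ mean π (g ^ 2) - mean π ((P.mulVec g) ^ 2) ∧
    asymptoticVariance μ f P π
      = ENNReal.ofReal (mean π (g ^ 2) - mean π ((P.mulVec g) ^ 2)) := by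
  have ht := h.tendsto_meanSqError hμ hP0 hP1 hπ hf
  refine ⟨ge_of_tendsto' ht fun n => mul_nonneg (by positivity) ?_,
    (ENNReal.tendsto_ofReal ht).limsup_eq⟩
  rw [meanSqError_eq_expect, ← expect_const hμ hP1 n 0]
  exact expect_mono hμ hP0 fun x => sq_nonneg _

lemma tendsto_meanSqError_zero {f : I → ℝ} (hf : asymptoticVariance μ f P π ≠ ⊤) :
    Tendsto (meanSqError μ π P f) atTop (𝓝 0) := by
  obtain ⟨C, hC1, hC2⟩ := ENNReal.lt_iff_exists_nnreal_btwn.1 (lt_top_iff_ne_top.2 hf)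
  have hev := eventually_lt_of_limsup_lt hC1
  have h : Tendsto (fun n : ℕ => (C : ℝ) / ((n : ℝ) + 1)) atTop (𝓝 0) :=
    tendsto_const_nhds.div_atTop (tendsto_atTop_add_const_right _ _ tendsto_natCast_atTop_atTop)
  refine tendsto_of_tendsto_of_tendsto_of_le_of_le' tendsto_const_nhds h
    (Eventually.of_forall fun n => ?_) ?_
  · rw [meanSqError_eq_expect, ← expect_const hμ hP1 n 0]
    exact expect_mono hμ hP0 fun x => sq_nonneg _
  · filter_upwards [hev] with n hn
    rw [le_div_iff₀ (by positivity), mul_comm]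
    rw [← ENNReal.ofReal_coe_nnreal] at hn
    exact (ENNReal.lt_ofReal_iff_toReal_lt (by simp)).1 hn |>.le.trans' (by
      rw [ENNReal.toReal_ofReal']; exact le_max_left _ _)

/-- Finite variance forces the mean squared error to 0, and by Jensen it dominates the squared bias.
-/
lemma isErgodicTo_of_asymptoticVariance_ne_top
    (h : ∀ f, asymptoticVariance μ f P π ≠ ⊤) : IsErgodicTo μ P π := by
  intro f
  have hlim := tendsto_meanSqError_zero hμ hP0 hP1 (h f)
  have hsq : ∀ n : ℕ, |(∑ k ∈ range (n + 1), marginal μ P k f) / ((n : ℝ) + 1) - mean π f|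
      ≤ √(meanSqError μ π P f n) := by
    intro n
    refine Real.abs_le_sqrt ?_
    rw [meanSqError_eq_expect]
    refine le_trans (le_of_eq ?_) (sq_expect_le hμ hP0 hP1 n _)
    rw [expect_sub, expect_const_mul, expect_const hμ hP1, expect_sum hP1]
    ring
  have h0 := squeeze_zero_norm (fun n => (Real.norm_eq_abs _).trans_le (hsq n))
    (by simpa using hlim.sqrt)
  simpa using h0.add_const (mean π f)

/-- If all asymptotic variances are finite, only constants are invariant along all transitions. -/
lemma eq_of_asymptoticVariance_ne_top (hπ0 : ∀ i, 0 < π i)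
    (h : ∀ f, asymptoticVariance μ f P π ≠ ⊤) {v : I → ℝ}
    (hv : ∀ i j, 0 < P i j → v i = v j) (i j : I) : v i = v j := by
  set u : I → ℝ := fun i => (v i - mean π v) ^ 2 with hu
  have hharm : P.mulVec u = u := by
    ext i
    have : ∀ j, P i j * u j = P i j * u i := fun j => by
      rcases (hP0 i j).eq_or_lt with h | h
      · simp [← h]
      · simp only [hu, hv i j h]
    change ∑ j, P i j * u j = u i
    rw [sum_congr rfl fun j _ => this j, ← sum_mul, hP1, one_mul]
  have hmarg : ∀ n, marginal μ P n u = marginal μ P 0 u := fun n => by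
    induction n with
    | zero => rfl
    | succ n ih => rw [marginal_succ, hharm, ih]
  -- Trajectories of positive probability keep `v` constant, so time averaging does not reduce the
  -- error.
  have hMS : ∀ n : ℕ, meanSqError μ π P v n = marginal μ P 0 u := by
    intro n
    rw [meanSqError_eq_expect, ← hmarg n, marginal, expect, expect]
    refine sum_congr rfl fun x _ => ?_
    by_cases hx : pathProb μ P n x = 0
    · rw [hx, zero_mul, zero_mul]
    have hstep : ∀ k : Fin n, 0 < P (x k.castSucc) (x k.succ) := fun k =>
      (hP0 _ _).lt_of_ne' fun h0 => hx (by
        rw [pathProb, prod_eq_zero (mem_univ k) h0, mul_zero])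
    have hk : ∀ k, v (x k) = v (x 0) := fun k => by
      induction k using Fin.induction with
      | zero => rfl
      | succ k ih => rw [← hv _ _ (hstep k), ih]
    have hn : (n : ℝ) + 1 ≠ 0 := by positivity
    simp only [hu, hk, sum_const, card_univ, Fintype.card_fin, nsmul_eq_mul]
    push_cast
    field_simp
  have h0 : marginal μ P 0 u = 0 := by
    have := tendsto_meanSqError_zero hμ hP0 hP1 (h v)
    exact tendsto_nhds_unique (tendsto_const_nhds.congr fun n => (hMS n).symm) this
  have h1 : mean π u = 0 := by
    refine tendsto_nhds_unique (isErgodicTo_of_asymptoticVariance_ne_top hμ hP0 hP1 h u) ?_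
    simp [hmarg, h0]
  have h2 : ∀ i, v i = mean π v := fun i => by
    have := (sum_eq_zero_iff_of_nonneg fun i _ =>
      mul_nonneg (sq_nonneg (v i - mean π v)) (hπ0 i).le).1 h1 i (mem_univ i)
    have := (mul_eq_zero.1 this).resolve_right (hπ0 i).ne'
    exact sub_eq_zero.1 (pow_eq_zero_iff two_ne_zero |>.1 this)
  rw [h2 i, h2 j]

end asymptotics

end MarkovVar

/-! ### From chains to flows, and the conclusion -/

namespace MarkovVar

open Finset Filter Topology

variable {I : Type*}

lemma forall_of_isIrreducible {P : Matrix I I ℝ} (hP : P.IsIrreducible) {p : I → Prop}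
    (hp : ∀ i j, p i → 0 < P i j → p j) {o : I} (ho : p o) (i : I) : p i := by
  let : Quiver I := P.toQuiver
  obtain ⟨w, -⟩ := hP.connected o i
  induction w with
  | nil => exact ho
  | cons _ e ih => exact hp _ _ ih e.down

/-- The stationary flow `π i * P i j` of a chain. -/
def flow (π : I → ℝ) (P : Matrix I I ℝ) : Matrix I I ℝ := Matrix.of fun i j => π i * P i j

variable {π : I → ℝ} {P : Matrix I I ℝ}

lemma flow_apply (π : I → ℝ) (P : Matrix I I ℝ) (i j : I) : flow π P i j = π i * P i j := rfl

variable [Fintype I]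

lemma sum_flow (hP1 : ∀ i, ∑ j, P i j = 1) (i : I) : ∑ j, flow π P i j = π i := by
  simp only [flow_apply, ← mul_sum, hP1, mul_one]

lemma lap_flow (hP1 : ∀ i, ∑ j, P i j = 1) (v : I → ℝ) (i : I) :
    lap (flow π P) v i = π i * (v i - P.mulVec v i) := by
  have : P.mulVec v i = ∑ j, P i j * v j := rfl
  have h : v i = ∑ j, P i j * v i := by rw [← sum_mul, hP1, one_mul]
  rw [lap_apply, this]
  conv_rhs => rw [h, ← sum_sub_distrib, mul_sum]
  exact sum_congr rfl fun j _ => by rw [flow_apply]; ring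

/-- Pointwise `a² - b² = 2 a (a - b) - (a - b)²`; the last sum depends only on `(1 - P) g`, so it
cancels when two chains are compared on the same `f`. -/
lemma mean_sq_sub_eq (hP1 : ∀ i, ∑ j, P i j = 1) (g : I → ℝ) :
    mean π (g ^ 2) - mean π ((P.mulVec g) ^ 2)
      = 2 * g ⬝ᵥ lap (flow π P) g - ∑ i, π i * (g i - P.mulVec g i) ^ 2 := by
  simp only [mean, dotProduct, lap_flow hP1, mul_sum, ← sum_sub_distrib, Pi.pow_apply]
  exact sum_congr rfl fun i _ => by ring

lemma isConnected_flow_of_forall (hb : IsBalanced (flow π P)) (hπ0 : ∀ i, 0 < π i)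
    (hP0 : ∀ i j, 0 ≤ P i j)
    (h : ∀ v : I → ℝ, (∀ i j, 0 < P i j → v i = v j) → ∀ i j, v i = v j) :
    IsConnected (flow π P) := fun v hv => h v fun i _ hij =>
  eq_of_energy_eq_zero hb (fun i j => mul_nonneg (hπ0 i).le (hP0 i j)) hv (mul_pos (hπ0 i) hij)

/-- The Poisson equation of a chain with connected stationary flow is solvable. -/
lemma exists_poisson (hP1 : ∀ i, ∑ j, P i j = 1) (hπ0 : ∀ i, 0 < π i) (hπ1 : ∑ i, π i = 1)
    (hb : IsBalanced (flow π P)) (hc : IsConnected (flow π P)) (f : I → ℝ) :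
    ∃ g : I → ℝ, ∀ i, f i = g i - P.mulVec g i + mean π f := by
  obtain ⟨g, hg⟩ := exists_lap_eq hb hc (f := fun i => π i * (f i - mean π f)) (by
    simp only [mul_sub, sum_sub_distrib, ← sum_mul, hπ1, one_mul]
    simp only [mean, mul_comm, sub_self])
  refine ⟨g, fun i => ?_⟩
  have := congrFun hg i
  rw [lap_flow hP1] at this
  linarith [mul_left_cancel₀ (hπ0 i).ne' this]

lemma isBalanced_flow_of_mean_mulVec (hP1 : ∀ i, ∑ j, P i j = 1)
    (h : ∀ f, mean π (P.mulVec f) = mean π f) : IsBalanced (flow π P) := by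
  classical
  intro i
  have := h (Pi.single i 1)
  rw [sum_flow hP1]
  simp only [mean, Matrix.mulVec_single_one, Matrix.col_apply, Pi.single_apply, ite_mul, one_mul,
    zero_mul, sum_ite_eq', mem_univ, if_true] at this
  rw [← this]
  exact sum_congr rfl fun j _ => mul_comm _ _

/-- No other chain has asymptotic variances below those of an irreducible reversible chain on a
tree with at most one loop. -/
theorem eq_of_asymptoticVariance_le [DecidableEq I] {μ : I → ℝ} (hπ : π ∈ stdSimplex ℝ I)
    (hμ : μ ∈ stdSimplex ℝ I) (hP : P ∈ Matrix.rowStochastic ℝ I) (hirr : P.IsIrreducible)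
    (hrev : IsReversible π P) (hdiag : ∀ i j, P i i ≠ 0 → P j j ≠ 0 → i = j)
    (hacyc : (transitionGraph P).IsAcyclic) {P' : Matrix I I ℝ}
    (hP' : P' ∈ Matrix.rowStochastic ℝ I)
    (hle : ∀ f : I → ℝ, asymptoticVariance μ f P' π ≤ asymptoticVariance μ f P π) : P' = P := by
  obtain ⟨hP0, hP1⟩ := Matrix.mem_rowStochastic_iff_sum.1 hP
  obtain ⟨hQ0, hQ1⟩ := Matrix.mem_rowStochastic_iff_sum.1 hP'
  -- Detailed balance carries positivity of `π` along every transition.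
  have hπpos : ∀ i, 0 < π i := by
    obtain ⟨o, -, ho⟩ : ∃ o ∈ univ, 0 < π o := by
      by_contra! h
      linarith [hπ.2, sum_nonpos h]
    refine forall_of_isIrreducible hirr (p := fun i => 0 < π i) (fun i j hi hij => ?_) ho
    refine (hπ.1 j).lt_of_ne' fun h => ?_
    have := hrev i j
    rw [h, zero_mul] at this
    exact (mul_pos hi hij).ne' this
  have hGsymm : ∀ i j, flow π P i j = flow π P j i := hrev
  have hGb : IsBalanced (flow π P) := fun i => sum_congr rfl fun j _ => hGsymm i j
  have hPc : ∀ v : I → ℝ, (∀ i j, 0 < P i j → v i = v j) → ∀ i j, v i = v j := fun v hv i j =>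
    forall_of_isIrreducible hirr (p := fun k => v k = v j)
      (fun k l hk hkl => (hv k l hkl).symm.trans hk) rfl i
  have hGc := isConnected_flow_of_forall hGb hπpos hP0 hPc
  have hpoisson := exists_poisson hP1 hπpos hπ.2 hGb hGc
  have hPe := isErgodicTo_of_poisson hμ hP0 hP1 hpoisson
  have hfin : ∀ f, asymptoticVariance μ f P' π ≠ ⊤ := fun f => by
    refine ne_top_of_le_ne_top ?_ (hle f)
    obtain ⟨g, hg⟩ := hpoisson f
    rw [(hPe.asymptoticVariance_eq hμ hP0 hP1 hπ.2 hg).2]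
    exact ENNReal.ofReal_ne_top
  have hQe := isErgodicTo_of_asymptoticVariance_ne_top hμ hQ0 hQ1 hfin
  have hFb := isBalanced_flow_of_mean_mulVec hQ1 (hQe.mean_mulVec hμ hQ0 hQ1)
  have hFc := isConnected_flow_of_forall hFb hπpos hQ0 fun v hv =>
    eq_of_asymptoticVariance_ne_top hμ hQ0 hQ1 hπpos hfin hv
  have hadj : ∀ i j, (transitionGraph P).Adj i j ↔ i ≠ j ∧ 0 < P i j := fun i j => by
    rw [transitionGraph, SimpleGraph.fromRel_adj]
    refine and_congr_right fun _ => or_iff_left_of_imp fun h => ?_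
    have h1 := mul_pos (hπpos j) h
    rw [← hrev i j] at h1
    exact pos_of_mul_pos_right h1 (hπpos i).le
  -- Without loops any state can serve as the root.
  obtain ⟨r, hr⟩ : ∃ r, ∀ i, i ≠ r → flow π P i i = 0 := by
    by_cases h : ∃ r, P r r ≠ 0
    · obtain ⟨r, hr⟩ := h
      refine ⟨r, fun i hi => ?_⟩
      rw [flow_apply, not_not.1 fun h => hi (hdiag i r h hr), mul_zero]
    · push Not at h
      obtain ⟨o, -⟩ : (univ : Finset I).Nonempty := by
        rw [nonempty_iff_ne_empty]
        intro h0
        have := hπ.2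
        simp [h0] at this
      exact ⟨o, fun i _ => by rw [flow_apply, h, mul_zero]⟩
  have key : flow π P' = flow π P := by
    refine eq_of_energy_le hacyc (fun v hv => hPc v fun i j hij => ?_) hGsymm
      (fun i j hij h => ?_) (fun i j h => mul_pos (hπpos i) ((hadj i j).1 h).2) hGc hFb
      (fun i j => mul_nonneg (hπpos i).le (hQ0 i j)) hFc
      (fun i => by rw [sum_flow hP1, sum_flow hQ1]) r hr fun g h hgh => ?_
    · by_cases h : i = j
      · rw [h]
      · exact hv i j ((hadj i j).2 ⟨h, hij⟩)
    · rw [hadj, not_and, not_lt] at h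
      rw [flow_apply, le_antisymm (h hij) (hP0 i j), mul_zero]
    · have hf : ∀ i, g i - P'.mulVec g i = h i - P.mulVec h i := fun i => by
        have := congrFun hgh i
        rw [lap_flow hP1, lap_flow hQ1] at this
        exact mul_left_cancel₀ (hπpos i).ne' this
      have h1 := hQe.asymptoticVariance_eq hμ hQ0 hQ1 hπ.2 (g := g) (m := 0)
        (f := fun i => g i - P'.mulVec g i) fun i => by ring
      have h2 := hPe.asymptoticVariance_eq hμ hP0 hP1 hπ.2 (g := h) (m := 0)
        (f := fun i => g i - P'.mulVec g i) fun i => by rw [hf]; ring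
      have h3 := hle fun i => g i - P'.mulVec g i
      rw [h1.2, h2.2, ENNReal.ofReal_le_ofReal_iff h2.1, mean_sq_sub_eq hQ1, mean_sq_sub_eq hP1]
        at h3
      simp only [hf] at h3
      linarith
  ext i j
  have := congrFun (congrFun key i) j
  exact mul_left_cancel₀ (hπpos i).ne' this

end MarkovVar

theorem theorem1 {I : Type*} [Fintype I] [DecidableEq I]
    (π : I → ℝ) (hπ : π ∈ stdSimplex ℝ I)
    (μ : I → ℝ) (hμ : μ ∈ stdSimplex ℝ I)
    (P : Matrix I I ℝ) (hP : P ∈ Matrix.rowStochastic ℝ I)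
    (hirr : P.IsIrreducible) (hrev : MarkovVar.IsReversible π P)
    (hdiag : ∀ i j, P i i ≠ 0 → P j j ≠ 0 → i = j)
    (hacyc : (MarkovVar.transitionGraph P).IsAcyclic) :
    (∀ P' ∈ Matrix.rowStochastic ℝ I,
      (∀ f : I → ℝ, MarkovVar.asymptoticVariance μ f P' π ≤ MarkovVar.asymptoticVariance μ f P π) →
        P' = P) ∧
    ¬ ∃ P' ∈ Matrix.rowStochastic ℝ I, MarkovVar.UniformlyBetter μ π P' P := by
  have key : ∀ P' ∈ Matrix.rowStochastic ℝ I,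
      (∀ f : I → ℝ, MarkovVar.asymptoticVariance μ f P' π ≤ MarkovVar.asymptoticVariance μ f P π) →
        P' = P := fun P' hP' hle =>
    MarkovVar.eq_of_asymptoticVariance_le hπ hμ hP hirr hrev hdiag hacyc hP' hle
  refine ⟨key, ?_⟩
  rintro ⟨P', hP', hle, f, hf⟩
  rw [key P' hP' hle] at hf
  exact lt_irrefl _ hf
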